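/- For $f:\{0,1\}^n\to\mathbb{R}$ and $S\subseteq[n]$ let $\chi_S(x)=(-1)^{\sum_{i\in S}x_i}$ and $\hat f(S)=\mathbb{E}_x[f(x)\chi_S(x)]$, where $x$ is uniform on $\{0,1\}^n$; let $W^{>d}(f)=\sum_{|S|>d}\hat f(S)^2$ and $\|f\|_2=(\mathbb{E}_x[f(x)^2])^{1/2}$. Let $\deg^{\ell_2}_\varepsilon(f)$ be the smallest $d$ for which there is a real polynomial $p$ of degree at most $d$ with $\|f-p\|_2\le\varepsilon$. For $1\le k\le n$ let $$\mathsf{hs}_k(x)=\min\Big\{1,\ \tfrac{2}{k}\sum_{i=1}^k x_i\Big\},\qquad x\in\{0,1\}^n .$$ 1. There is an absolute constant $c>0$ such that for all integers $n,k,d$ with $k\le n$ and $1\le d\le k/2$, $$W^{>d}(\mathsf{hs}_k)\ \ge\ c\cdot\frac{d^{-3/2}}{k}.$$ 2. There are absolute constants $c_1,c_2>0$ such that for every real $\varepsilon>0$ for which $k=\lfloor c_1\varepsilon^{-4/5}\rfloor$ is at least $1$ (that is, for every $0<\varepsilon\le c_1^{5/4}$) and for every $n\ge k$, $$W^{>\lfloor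 k/2\rfloor}(\mathsf{hs}_k)\ \ge\ \varepsilon^2\qquad\text{and}\qquad \deg^{\ell_2}_\varepsilon(\mathsf{hs}_k)\ \ge\ c_2\,\varepsilon^{-4/5}.$$ 3. For all $1\le k\le n$ the function $\mathsf{hs}_k$ takes values in $[0,1]$, is monotone (coordinatewise non-decreasing), is submodular ($f(x\vee y)+f(x\wedge y)\le f(x)+f(y)$ for all $x,y$), and is symmetric in its $k$ variables: it is invariant under every permutation of the $n$ coordinates that maps the first $k$ coordinates to themselves. -/

import Mathlib

/-- The parity function `χ_S(x) = (-1)^{∑_{i ∈ S} x_i}` on the cube `{0,1}^n`. -/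
def parity {n : ℕ} (S : Finset (Fin n)) (x : Fin n → Bool) : ℝ :=
  (-1) ^ (∑ i ∈ S, (x i).toNat)

/-- The expectation of `f` under the uniform distribution on `{0,1}^n`. -/
noncomputable def cubeMean {n : ℕ} (f : (Fin n → Bool) → ℝ) : ℝ :=
  (∑ x, f x) / 2 ^ n

/-- The Fourier coefficient `f̂(S) = 𝔼[f χ_S]`. -/
noncomputable def cubeFourierCoeff {n : ℕ} (f : (Fin n → Bool) → ℝ) (S : Finset (Fin n)) : ℝ :=
  cubeMean fun x => f x * parity S x

/-- The Fourier weight `W^j(f) = ∑_{|S| = j} f̂(S)^2` at level `j`. -/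
noncomputable def fourierWeight {n : ℕ} (f : (Fin n → Bool) → ℝ) (j : ℕ) : ℝ :=
  ∑ S ∈ Finset.powersetCard j (Finset.univ : Finset (Fin n)), cubeFourierCoeff f S ^ 2

/-- The Fourier weight `W^{>d}(f) = ∑_{j > d} W^j(f)` above level `d`
(there are no sets of size larger than `n`). -/
noncomputable def fourierWeightAbove {n : ℕ} (f : (Fin n → Bool) → ℝ) (d : ℕ) : ℝ :=
  ∑ j ∈ Finset.Ioc d n, fourierWeight f j

/-- The `ℓ₂` norm `‖f‖₂ = (𝔼[f^2])^{1/2}` over the uniform distribution. -/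
noncomputable def cubeL2Norm {n : ℕ} (f : (Fin n → Bool) → ℝ) : ℝ :=
  Real.sqrt (cubeMean fun x => f x ^ 2)

/-- The value at a point of `{0,1}^n` of a real polynomial in `n` variables. -/
noncomputable def evalCube {n : ℕ} (p : MvPolynomial (Fin n) ℝ) (x : Fin n → Bool) : ℝ :=
  MvPolynomial.eval (fun i => ((x i).toNat : ℝ)) p

/-- The `(ℓ₂, ε)`-approximate degree of `f`: the smallest `d` such that some real polynomial `p` of
degree at most `d` satisfies `‖f - p‖₂ ≤ ε`. For `ε ≥ 0` such a `d` exists, as every function on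
the cube is a polynomial. -/
noncomputable def approxDegree {n : ℕ} (ε : ℝ) (f : (Fin n → Bool) → ℝ) : ℕ :=
  sInf {d : ℕ | ∃ p : MvPolynomial (Fin n) ℝ,
    p.totalDegree ≤ d ∧ cubeL2Norm (fun x => f x - evalCube p x) ≤ ε}

/-- Submodularity; on `{0,1}^n` the join and meet are the union and intersection of sets. -/
def Submodular {n : ℕ} (f : (Fin n → Bool) → ℝ) : Prop :=
  ∀ x y, f (x ⊔ y) + f (x ⊓ y) ≤ f x + f y

/-- The Hamming weight `w_k(x)` of the first `k` bits of `x`. -/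
def prefixWeight {n : ℕ} (k : ℕ) (x : Fin n → Bool) : ℕ :=
  ∑ i with i.val < k, (x i).toNat

/-- The hockey-stick function `hs_k(x) = min {1, 2 w_k(x) / k}` on `{0,1}^n`. -/
noncomputable def hockeyStick (n k : ℕ) (x : Fin n → Bool) : ℝ :=
  min 1 (2 * (prefixWeight k x : ℝ) / k)

open Finset

/-! ### Fourier analysis on the cube -/

/-! The Fourier weight of the hockey stick comes from its single kink at `k/2`. The generating
function of `χ_S` by prefix weight is, up to a power of 2, `(1 - X)^|S| (1 + X)^(k - |S|)`, and a
factor `1 - X` acts on the profile `w ↦ min 1 (2w/k)` as a difference operator. Two such factors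
leave a second difference supported at the kink, so for `|S| = 2r + 2` the coefficient of `S` is a
multiple of `[X^(r+s)] (1 - X)^(2r) (1 + X)^(2s)`, a signed super Catalan number
(`cubeFourierCoeff_hockeyStick`).

Squared and multiplied by `choose (2(r+s)) (2r)`, this number is a product of three central
binomials (`choose_mul_superCatalan_sq`), each of order `4^m/√m`. Hence each even level just above
`d` has weight at least of order `d^(-5/2)/k`, and about `d/4` such levels give `d^(-3/2)/k`.

At `d = ⌊k/2⌋` the bound is of order `k^(-5/2)`, which exceeds `ε²` when `k` is a small multiple of
`ε^(-4/5)`. A polynomial of degree at most `d` cannot reduce the weight above `d`, so the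
approximate degree exceeds `k/2`. -/

theorem sum_cube_prod {R : Type*} [CommSemiring R] {n : ℕ} (f : Fin n → Bool → R) :
    ∑ x : Fin n → Bool, ∏ i, f i (x i) = ∏ i, (f i true + f i false) := by
  have h := Finset.prod_univ_sum (fun _ : Fin n => (Finset.univ : Finset Bool)) f
  rw [Fintype.piFinset_univ] at h
  rw [← h]
  simp

theorem parity_eq_prod {n : ℕ} (S : Finset (Fin n)) (x : Fin n → Bool) :
    parity S x = ∏ i, if i ∈ S then (-1 : ℝ) ^ (x i).toNat else 1 := by
  rw [Finset.prod_ite_mem, Finset.univ_inter, Finset.prod_pow_eq_pow_sum, parity]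

theorem sum_parity_mul_parity {n : ℕ} (x y : Fin n → Bool) :
    ∑ S, parity S x * parity S y = if x = y then (2 : ℝ) ^ n else 0 := by
  have h : ∀ S : Finset (Fin n), parity S x * parity S y
      = ∏ i ∈ S, (-1 : ℝ) ^ ((x i).toNat + (y i).toNat) := fun S => by
    simp only [parity, ← Finset.prod_pow_eq_pow_sum, ← Finset.prod_mul_distrib, pow_add]
  simp_rw [h]
  rw [← Finset.powerset_univ, ← Finset.prod_one_add]
  split_ifs with hxy
  · subst hxy
    rw [Finset.prod_congr rfl (g := fun _ => (2 : ℝ))]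
    · simp
    · intro i _
      rw [← two_mul, pow_mul]
      norm_num
  · obtain ⟨i, hi⟩ := Function.ne_iff.mp hxy
    refine Finset.prod_eq_zero (Finset.mem_univ i) ?_
    cases hx : x i <;> cases hy : y i <;> simp_all

theorem sum_sq_cubeFourierCoeff {n : ℕ} (f : (Fin n → Bool) → ℝ) :
    ∑ S, cubeFourierCoeff f S ^ 2 = cubeMean fun x => f x ^ 2 := by
  have h : ∀ S, cubeFourierCoeff f S ^ 2
      = (∑ x, ∑ y, f x * f y * (parity S x * parity S y)) / (2 ^ n * 2 ^ n) := fun S => by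
    rw [cubeFourierCoeff, cubeMean, div_pow, sq, Finset.sum_mul_sum, sq]
    congr 1
    exact Finset.sum_congr rfl fun x _ => Finset.sum_congr rfl fun y _ => by ring
  simp_rw [h]
  rw [← Finset.sum_div, Finset.sum_comm]
  have h2 : ∀ x, ∑ S, ∑ y, f x * f y * (parity S x * parity S y) = f x ^ 2 * 2 ^ n := fun x => by
    rw [Finset.sum_comm]
    simp_rw [← Finset.mul_sum, sum_parity_mul_parity]
    simp [sq]
  simp_rw [h2]
  rw [← Finset.sum_mul, cubeMean]
  field_simp

theorem fourierWeightAbove_eq_sum {n : ℕ} (f : (Fin n → Bool) → ℝ) (d : ℕ) :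
    fourierWeightAbove f d = ∑ S with d < S.card, cubeFourierCoeff f S ^ 2 := by
  rw [fourierWeightAbove, ← Finset.sum_fiberwise_of_maps_to (t := Finset.Ioc d n)
    (g := Finset.card)]
  · refine Finset.sum_congr rfl fun j hj => ?_
    rw [fourierWeight]
    refine Finset.sum_congr ?_ fun _ _ => rfl
    ext S
    simp only [Finset.mem_Ioc] at hj
    simp only [Finset.mem_powersetCard, Finset.subset_univ, true_and, Finset.mem_filter,
      Finset.mem_univ]
    omega
  · intro S hS
    have := Finset.card_le_univ S
    simp_all

theorem fourierWeight_nonneg {n : ℕ} (f : (Fin n → Bool) → ℝ) (j : ℕ) : 0 ≤ fourierWeight f j :=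
  Finset.sum_nonneg fun _ _ => sq_nonneg _

theorem cubeFourierCoeff_sub {n : ℕ} (f g : (Fin n → Bool) → ℝ) (S : Finset (Fin n)) :
    cubeFourierCoeff (fun x => f x - g x) S = cubeFourierCoeff f S - cubeFourierCoeff g S := by
  simp only [cubeFourierCoeff, cubeMean, sub_mul, Finset.sum_sub_distrib, sub_div]

theorem cubeFourierCoeff_evalCube {n : ℕ} (p : MvPolynomial (Fin n) ℝ) (S : Finset (Fin n))
    (h : p.totalDegree < S.card) : cubeFourierCoeff (evalCube p) S = 0 := by
  rw [cubeFourierCoeff, cubeMean, div_eq_zero_iff]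
  left
  simp only [evalCube, MvPolynomial.eval_eq', Finset.sum_mul]
  rw [Finset.sum_comm]
  refine Finset.sum_eq_zero fun α hα => ?_
  -- A monomial of degree below `|S|` misses some variable `i ∈ S`; the sum over `x i` is then `1 +
  -- (-1) = 0`.
  have hsupp : α.support.card < S.card := by
    refine lt_of_le_of_lt ?_ ((MvPolynomial.le_totalDegree hα).trans_lt h)
    rw [Finsupp.sum, Finset.card_eq_sum_ones]
    exact Finset.sum_le_sum fun i hi => Nat.one_le_iff_ne_zero.mpr (Finsupp.mem_support_iff.mp hi)
  obtain ⟨i, hiS, hi⟩ := Finset.exists_mem_notMem_of_card_lt_card hsupp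
  simp only [parity_eq_prod, mul_assoc, ← Finset.mul_sum, ← Finset.prod_mul_distrib]
  rw [sum_cube_prod fun i b => ((b.toNat : ℝ)) ^ α i * if i ∈ S then (-1 : ℝ) ^ b.toNat else 1]
  rw [Finset.prod_eq_zero (Finset.mem_univ i), mul_zero]
  simp [hiS, Finsupp.notMem_support_iff.mp hi]

/-- Subtracting `p` leaves the coefficients above level `d` unchanged, and Parseval bounds their
squares by the squared error. -/
theorem fourierWeightAbove_le_of_approx {n d : ℕ} {f : (Fin n → Bool) → ℝ} {ε : ℝ}
    {p : MvPolynomial (Fin n) ℝ} (hp : p.totalDegree ≤ d)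
    (h : cubeL2Norm (fun x => f x - evalCube p x) ≤ ε) : fourierWeightAbove f d ≤ ε ^ 2 := by
  calc fourierWeightAbove f d
      = ∑ S with d < S.card, cubeFourierCoeff (fun x => f x - evalCube p x) S ^ 2 := by
        rw [fourierWeightAbove_eq_sum]
        refine Finset.sum_congr rfl fun S hS => ?_
        rw [cubeFourierCoeff_sub, cubeFourierCoeff_evalCube p S, sub_zero]
        exact hp.trans_lt (Finset.mem_filter.mp hS).2
    _ ≤ ∑ S, cubeFourierCoeff (fun x => f x - evalCube p x) S ^ 2 :=
        Finset.sum_le_sum_of_subset_of_nonneg (Finset.filter_subset _ _)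
          fun _ _ _ => sq_nonneg _
    _ = cubeL2Norm (fun x => f x - evalCube p x) ^ 2 := by
        rw [sum_sq_cubeFourierCoeff, cubeL2Norm, Real.sq_sqrt]
        exact div_nonneg (Finset.sum_nonneg fun _ _ => sq_nonneg _) (by positivity)
    _ ≤ ε ^ 2 := pow_le_pow_left₀ (Real.sqrt_nonneg _) h 2

theorem exists_evalCube_eq {n : ℕ} (f : (Fin n → Bool) → ℝ) :
    ∃ p : MvPolynomial (Fin n) ℝ, evalCube p = f := by
  refine ⟨∑ y, MvPolynomial.C (f y) *
    ∏ i, if y i then MvPolynomial.X i else 1 - MvPolynomial.X i, ?_⟩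
  funext x
  simp only [evalCube, map_sum, map_mul, MvPolynomial.eval_C, map_prod]
  rw [Finset.sum_eq_single x]
  · rw [Finset.prod_eq_one, mul_one]
    intro i _
    cases hx : x i <;> simp [hx]
  · intro y _ hy
    obtain ⟨i, hi⟩ := Function.ne_iff.mp hy
    rw [Finset.prod_eq_zero (Finset.mem_univ i), mul_zero]
    cases hx : x i <;> cases hy : y i <;> simp_all
  · simp

theorem lt_approxDegree {n d : ℕ} {f : (Fin n → Bool) → ℝ} {ε : ℝ} (hε : 0 ≤ ε)
    (h : ε ^ 2 < fourierWeightAbove f d) : d < approxDegree ε f := by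
  by_contra! hd
  -- Nonemptiness rules out the default value `sInf ∅ = 0`, so the infimum is attained.
  have hne : {d : ℕ | ∃ p : MvPolynomial (Fin n) ℝ,
      p.totalDegree ≤ d ∧ cubeL2Norm (fun x => f x - evalCube p x) ≤ ε}.Nonempty := by
    obtain ⟨p, rfl⟩ := exists_evalCube_eq f
    exact ⟨_, p, le_rfl, by simpa [cubeL2Norm, cubeMean] using hε⟩
  obtain ⟨p, hp, hpε⟩ := Nat.sInf_mem hne
  exact (fourierWeightAbove_le_of_approx (hp.trans hd) hpε).not_gt h

/-! ### Order properties and symmetry of the hockey stick -/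

theorem prefixWeight_mono {n : ℕ} (k : ℕ) : Monotone (prefixWeight (n := n) k) := fun x y h =>
  Finset.sum_le_sum fun i _ => by
    have := h i
    revert this
    cases x i <;> cases y i <;> simp

theorem prefixWeight_sup_add_inf {n : ℕ} (k : ℕ) (x y : Fin n → Bool) :
    prefixWeight k (x ⊔ y) + prefixWeight k (x ⊓ y) = prefixWeight k x + prefixWeight k y := by
  simp only [prefixWeight, ← Finset.sum_add_distrib]
  refine Finset.sum_congr rfl fun i _ => ?_
  simp only [Pi.sup_apply, Pi.inf_apply]
  cases x i <;> cases y i <;> simp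

theorem hockeyStick_mem_Icc (n k : ℕ) (x : Fin n → Bool) :
    hockeyStick n k x ∈ Set.Icc (0 : ℝ) 1 :=
  ⟨le_min zero_le_one (by positivity), min_le_left _ _⟩

theorem hockeyStick_monotone (n k : ℕ) : Monotone (hockeyStick n k) := fun x y h => by
  have : (prefixWeight k x : ℝ) ≤ prefixWeight k y := by exact_mod_cast prefixWeight_mono k h
  unfold hockeyStick
  gcongr

/-- The linear part `2w/k` is modular, and the truncation `min 1` is concave: of two pairs with
equal sum, the more spread-out one (meet and join) has the smaller truncated sum. -/
theorem hockeyStick_submodular (n k : ℕ) : Submodular (hockeyStick n k) := fun x y => by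
  have hs : (2 * prefixWeight k (x ⊔ y) / k : ℝ) + 2 * prefixWeight k (x ⊓ y) / k
      = 2 * prefixWeight k x / k + 2 * prefixWeight k y / k := by
    have : (prefixWeight k (x ⊔ y) : ℝ) + prefixWeight k (x ⊓ y)
        = prefixWeight k x + prefixWeight k y := by exact_mod_cast prefixWeight_sup_add_inf k x y
    rw [← add_div, ← add_div, ← mul_add, ← mul_add, this]
  have h : ∀ u v : Fin n → Bool, u ≤ v →
      (2 * prefixWeight k u / k : ℝ) ≤ 2 * prefixWeight k v / k := fun u v huv => by
    have : (prefixWeight k u : ℝ) ≤ prefixWeight k v := by exact_mod_cast prefixWeight_mono k huv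
    gcongr
  have h1 := h (x ⊓ y) x inf_le_left
  have h2 := h (x ⊓ y) y inf_le_right
  have h3 := h x (x ⊔ y) le_sup_left
  have h4 := h y (x ⊔ y) le_sup_right
  simp only [hockeyStick, min_def]
  split_ifs <;> linarith

theorem hockeyStick_comp_perm {n k : ℕ} (σ : Equiv.Perm (Fin n))
    (hσ : ∀ i, (σ i).val < k ↔ i.val < k) (x : Fin n → Bool) :
    hockeyStick n k (x ∘ σ) = hockeyStick n k x := by
  have : prefixWeight k (x ∘ σ) = prefixWeight k x :=
    Finset.sum_equiv σ (by simp [hσ]) (by simp)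
  rw [hockeyStick, this, hockeyStick]

/-! ### Super Catalan numbers -/

/-- The super Catalan number `(2r)! (2s)! / (r! s! (r+s)!)`. -/
noncomputable def superCatalan (r s : ℕ) : ℝ :=
  r.centralBinom * s.centralBinom / (r + s).choose r

theorem centralBinom_succ_real (r : ℕ) :
    ((r + 1).centralBinom : ℝ) = 2 * (2 * r + 1) * r.centralBinom / (r + 1) := by
  rw [eq_div_iff (by positivity), mul_comm]
  exact_mod_cast r.succ_mul_centralBinom_succ

theorem superCatalan_succ_left (r s : ℕ) :
    superCatalan (r + 1) s = superCatalan r s * (2 * (2 * r + 1) / (r + s + 1)) := by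
  have h : ((r + 1 + s).choose (r + 1) : ℝ) = (r + s + 1) * (r + s).choose r / (r + 1) := by
    rw [eq_div_iff (by positivity), show r + 1 + s = (r + s) + 1 by ring]
    exact_mod_cast (Nat.add_one_mul_choose_eq (r + s) r).symm
  have hp : (0 : ℝ) < (r + s).choose r := by exact_mod_cast Nat.choose_pos (Nat.le_add_right r s)
  rw [superCatalan, superCatalan, h, centralBinom_succ_real]
  field_simp

theorem superCatalan_comm (r s : ℕ) : superCatalan r s = superCatalan s r := by
  rw [superCatalan, superCatalan, add_comm s r, Nat.choose_symm_add, mul_comm (r.centralBinom : ℝ)]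

theorem superCatalan_add (r s : ℕ) :
    superCatalan (r + 1) s + superCatalan r (s + 1) = 4 * superCatalan r s := by
  rw [superCatalan_comm r (s + 1), superCatalan_succ_left, superCatalan_succ_left,
    superCatalan_comm s r]
  field_simp
  ring

open Polynomial in
-- Since `(1 - X)^2 = (1 + X)^2 - 4X`, the coefficients satisfy, up to sign, the recurrence
-- `superCatalan_add`.
theorem coeff_one_sub_X_pow_mul_one_add_X_pow (r s : ℕ) :
    ((1 - X : ℝ[X]) ^ (2 * r) * (1 + X) ^ (2 * s)).coeff (r + s)
      = (-1) ^ r * superCatalan r s := by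
  induction r generalizing s with
  | zero => simp [Polynomial.coeff_one_add_X_pow, superCatalan, Nat.centralBinom_eq_two_mul_choose]
  | succ r ih =>
    have h : (1 - X : ℝ[X]) ^ (2 * (r + 1)) * (1 + X) ^ (2 * s)
        = (1 - X) ^ (2 * r) * (1 + X) ^ (2 * (s + 1))
          - C 4 * (X * ((1 - X) ^ (2 * r) * (1 + X) ^ (2 * s))) := by
      rw [show (C 4 : ℝ[X]) = 4 from rfl]
      ring
    rw [h, coeff_sub, coeff_C_mul, show r + 1 + s = r + (s + 1) by ring, ih,
      show r + (s + 1) = (r + s) + 1 by ring, coeff_X_mul, ih, pow_succ]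
    linear_combination (-1 : ℝ) ^ r * superCatalan_add r s

theorem choose_mul_superCatalan_sq (r s : ℕ) :
    ((2 * (r + s)).choose (2 * r) : ℝ) * superCatalan r s ^ 2
      = r.centralBinom * s.centralBinom * (r + s).centralBinom := by
  have hcb : ∀ m : ℕ, (m.centralBinom : ℝ) = (2 * m).factorial / (m.factorial * m.factorial) :=
    fun m => by
      rw [Nat.centralBinom_eq_two_mul_choose, Nat.cast_choose ℝ (by omega)]
      congr 3
      rw [show 2 * m - m = m by omega]
  rw [superCatalan, hcb, hcb, hcb, Nat.cast_choose ℝ (by omega : 2 * r ≤ 2 * (r + s)),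
    Nat.cast_choose ℝ (by omega : r ≤ r + s), show 2 * (r + s) - 2 * r = 2 * s by omega,
    Nat.add_sub_cancel_left]
  have h := fun m : ℕ => (Nat.cast_ne_zero (R := ℝ)).mpr m.factorial_ne_zero
  have h1 := h r
  have h2 := h s
  have h3 := h (r + s)
  have h4 := h (2 * r)
  have h5 := h (2 * s)
  have h6 := h (2 * (r + s))
  field_simp

theorem inv_le_centralBinom_div_four_pow (r : ℕ) :
    1 / (2 * Real.sqrt (r + 1)) ≤ (r.centralBinom : ℝ) / 4 ^ r := by
  have h : ∀ r : ℕ, (1 : ℝ) ≤ (4 * (r + 1)) * ((r.centralBinom : ℝ) / 4 ^ r) ^ 2 := fun r => by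
    suffices (4 * (r + 1) : ℝ) ≤ (4 * (r + 1)) * ((4 * r + 1) *
        ((r.centralBinom : ℝ) / 4 ^ r) ^ 2) by
      have h1 : (1 : ℝ) ≤ (4 * r + 1) * ((r.centralBinom : ℝ) / 4 ^ r) ^ 2 :=
        le_of_mul_le_mul_left (by linarith) (by positivity : (0 : ℝ) < 4 * (r + 1))
      nlinarith [sq_nonneg ((r.centralBinom : ℝ) / 4 ^ r)]
    -- With the factor `4r + 4` the induction step fails; with the sharper `4r + 1` it closes,
    -- because `(4r + 5)(2r + 1)^2` exceeds `4(4r + 1)(r + 1)^2` by exactly 1.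
    suffices (1 : ℝ) ≤ (4 * r + 1) * ((r.centralBinom : ℝ) / 4 ^ r) ^ 2 by
      nlinarith [(by positivity : (0 : ℝ) < 4 * (r + 1))]
    induction r with
    | zero => simp
    | succ r ih =>
      refine ih.trans ?_
      have : ((r + 1).centralBinom : ℝ) / 4 ^ (r + 1)
          = (r.centralBinom : ℝ) / 4 ^ r * ((2 * r + 1) / (2 * (r + 1))) := by
        rw [centralBinom_succ_real, pow_succ]
        field_simp
        ring
      rw [this, mul_pow, mul_comm (_ ^ 2), ← mul_assoc]
      refine mul_le_mul_of_nonneg_right ?_ (sq_nonneg _)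
      push_cast
      rw [div_pow, mul_div_assoc', le_div_iff₀ (by positivity)]
      ring_nf
      linarith
  rw [div_le_iff₀ (by positivity)]
  refine (one_le_sq_iff₀ (by positivity)).mp ?_
  rw [mul_pow, mul_pow, Real.sq_sqrt (by positivity)]
  linarith [h r]

/-! ### Generating functions of symmetric functions -/

open Polynomial in
/-- The linear functional on polynomials sending `X ^ w` to `g w`. -/
noncomputable def coeffPairing (g : ℕ → ℝ) : ℝ[X] →ₗ[ℝ] ℝ :=
  Polynomial.lsum fun w => g w • LinearMap.id

open Polynomial in
theorem coeffPairing_C_mul_X_pow (g : ℕ → ℝ) (c : ℝ) (w : ℕ) :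
    coeffPairing g (C c * X ^ w) = c * g w := by
  rw [C_mul_X_pow_eq_monomial, coeffPairing, lsum_apply, sum_monomial_index]
  · simp [mul_comm]
  · simp

open Polynomial in
-- The adjoint of multiplication by `1 + cX`: `c = -1` takes differences of `g`, and `c = 1` sums
-- neighbouring values.
theorem coeffPairing_one_add_C_mul_X_mul (g : ℕ → ℝ) (c : ℝ) (p : ℝ[X]) :
    coeffPairing g ((1 + C c * X) * p) = coeffPairing (fun w => g w + c * g (w + 1)) p := by
  induction p using Polynomial.induction_on' with
  | add p q hp hq => rw [mul_add, map_add, map_add, hp, hq]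
  | monomial w a =>
    have h : (1 + C c * X) * (C a * X ^ w) = C a * X ^ w + C (c * a) * X ^ (w + 1) := by
      rw [C_mul]
      ring
    rw [← C_mul_X_pow_eq_monomial, h, map_add]
    simp only [coeffPairing_C_mul_X_pow]
    ring

open Polynomial in
theorem coeffPairing_single (m : ℕ) (c : ℝ) (p : ℝ[X]) :
    coeffPairing (fun w => if w = m then c else 0) p = c * p.coeff m := by
  induction p using Polynomial.induction_on' with
  | add p q hp hq => rw [map_add, hp, hq, coeff_add, mul_add]
  | monomial w a =>
    rw [← C_mul_X_pow_eq_monomial, coeffPairing_C_mul_X_pow, coeff_C_mul_X_pow]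
    simp only [eq_comm (a := m)]
    split_ifs <;> ring

open Polynomial in
-- The sum of `χ_S(x) X^(w_k(x))` over the cube factors by coordinate: `1 - X` on `S`, `1 + X` on
-- the rest of the prefix, `2` beyond it.
theorem sum_mul_parity_eq_coeffPairing {n k : ℕ} (hk : k ≤ n) (g : ℕ → ℝ) (S : Finset (Fin n))
    (hS : ∀ i ∈ S, i.val < k) :
    ∑ x, g (prefixWeight k x) * parity S x
      = 2 ^ (n - k) * coeffPairing g ((1 - X) ^ S.card * (1 + X) ^ (k - S.card)) := by
  have hx : ∀ x : Fin n → Bool, (C (parity S x) * X ^ prefixWeight k x : ℝ[X])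
      = ∏ i, (C (if i ∈ S then (-1 : ℝ) ^ (x i).toNat else 1) *
          if i.val < k then X ^ (x i).toNat else 1) := fun x => by
    rw [Finset.prod_mul_distrib, ← map_prod, ← parity_eq_prod, ← Finset.prod_filter,
      Finset.prod_pow_eq_pow_sum, prefixWeight]
  have hsum := sum_cube_prod fun (i : Fin n) b =>
    (C (if i ∈ S then (-1 : ℝ) ^ b.toNat else 1) * if i.val < k then X ^ b.toNat else 1)
  simp_rw [← hx] at hsum
  have hfac : ∀ i : Fin n,
      ((C (if i ∈ S then (-1 : ℝ) ^ true.toNat else 1) * if i.val < k then X ^ true.toNat else 1)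
      + (C (if i ∈ S then (-1 : ℝ) ^ false.toNat else 1) *
        if i.val < k then X ^ false.toNat else 1) : ℝ[X])
      = if i.val < k then (if i ∈ S then 1 - X else 1 + X) else C 2 := fun i => by
    by_cases h1 : i ∈ S
    · simp [h1, hS i h1]
      ring
    · by_cases h2 : i.val < k
      · simp [h1, h2]
        ring
      · simp [h1, h2, show (C 2 : ℝ[X]) = 2 from rfl]
        norm_num
  simp_rw [hfac] at hsum
  have hcard : #{i : Fin n | i.val < k} = k := by rw [Fin.card_filter_val_lt]; omega
  have hin : ({i : Fin n | i.val < k} : Finset (Fin n)).filter (· ∈ S) = S := by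
    ext i
    simpa using hS i
  have hout : #(({i : Fin n | i.val < k} : Finset (Fin n)).filter (· ∉ S)) = k - #S := by
    have := Finset.card_filter_add_card_filter_not
      (s := ({i : Fin n | i.val < k} : Finset (Fin n))) (· ∈ S)
    rw [hin, hcard] at this
    omega
  have hrest : #{i : Fin n | ¬ i.val < k} = n - k := by
    have := Finset.card_filter_add_card_filter_not
      (s := (Finset.univ : Finset (Fin n))) (fun i => i.val < k)
    rw [hcard, Finset.card_univ, Fintype.card_fin] at this
    omega
  rw [Finset.prod_ite, Finset.prod_ite, Finset.prod_const, Finset.prod_const, Finset.prod_const,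
    hin, hout, hrest] at hsum
  have := congrArg (coeffPairing g) hsum
  rw [map_sum, ← C_pow, mul_comm, ← smul_eq_C_mul, map_smul] at this
  simp_rw [coeffPairing_C_mul_X_pow] at this
  rw [smul_eq_mul] at this
  rw [← this]
  exact Finset.sum_congr rfl fun _ _ => mul_comm _ _

/-! ### The Fourier weights of the hockey stick -/

theorem cubeFourierCoeff_hockeyStick {n k r s : ℕ} (hkn : k ≤ n)
    (hk : k = 2 * (r + s) + 1 ∨ k = 2 * (r + s) + 2) {S : Finset (Fin n)}
    (hS : ∀ i ∈ S, i.val < k) (hcard : S.card = 2 * r + 2) (hle : 2 * r + 2 ≤ k) :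
    cubeFourierCoeff (hockeyStick n k) S
      = -((-1) ^ r * superCatalan r s / 4 ^ (r + s)) / (2 * k) := by
  have h := sum_mul_parity_eq_coeffPairing hkn (fun w => min 1 (2 * (w : ℝ) / k)) S hS
  have h1X : (1 - Polynomial.X : Polynomial ℝ) = 1 + Polynomial.C (-1) * Polynomial.X := by
    simp [sub_eq_add_neg]
  have hk0 : (0 : ℝ) < k := by
    have : 0 < k := by omega
    exact_mod_cast this
  have hmin1 : ∀ w : ℕ, k ≤ 2 * w → min 1 (2 * (w : ℝ) / k) = 1 := fun w hw =>
    min_eq_left (by rw [one_le_div hk0]; exact_mod_cast hw)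
  have hmin2 : ∀ w : ℕ, 2 * w ≤ k → min 1 (2 * (w : ℝ) / k) = 2 * (w : ℝ) / k := fun w hw =>
    min_eq_right (by rw [div_le_one hk0]; exact_mod_cast hw)
  have hpow : (2 : ℝ) ^ n = 2 ^ (n - k) * 2 ^ k := by rw [← pow_add, Nat.sub_add_cancel hkn]
  have h4 : (4 : ℝ) ^ (r + s) = 2 ^ (2 * (r + s)) := by rw [pow_mul]; norm_num
  have hc := coeff_one_sub_X_pow_mul_one_add_X_pow r s
  rw [cubeFourierCoeff, cubeMean]
  simp only [hockeyStick]
  rw [h, hcard, pow_succ', pow_succ', mul_assoc, mul_assoc, h1X, coeffPairing_one_add_C_mul_X_mul,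
    coeffPairing_one_add_C_mul_X_mul, ← h1X, hpow, h4]
  rcases hk with hk | hk
  -- For odd `k`, the hypothesis `2r + 2 ≤ k` forces `s ≥ 1`.
  · obtain ⟨t, rfl⟩ : ∃ t, s = t + 1 := ⟨s - 1, by omega⟩
    -- The kink falls midway between two integers, so the second difference has two equal spikes.
    -- Read as a neighbour sum of one spike, they supply the factor `1 + X` missing from `(1 +
    -- X)^(2s - 1)`.
    have hfun : (fun w : ℕ => min 1 (2 * (w : ℝ) / k) + -1 * min 1 (2 * ((w + 1 : ℕ) : ℝ) / k) +
        -1 * (min 1 (2 * ((w + 1 : ℕ) : ℝ) / k) + -1 * min 1 (2 * ((w + 1 + 1 : ℕ) : ℝ) / k)))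
        = fun w => (fun w => if w = r + (t + 1) then (-1 / k : ℝ) else 0) w
          + 1 * (fun w => if w = r + (t + 1) then (-1 / k : ℝ) else 0) (w + 1) := by
      funext w
      have hkr : (k : ℝ) = 2 * (r + (t + 1)) + 1 := by rw [hk]; push_cast; ring
      rcases lt_trichotomy w (r + t) with hw | hw | hw
      · rw [hmin2 _ (by omega), hmin2 _ (by omega), hmin2 _ (by omega)]
        simp only [show w ≠ r + (t + 1) by omega, show w + 1 ≠ r + (t + 1) by omega, if_false]
        push_cast
        ring
      · rw [hmin2 w (by omega), hmin2 (w + 1) (by omega), hmin1 _ (by omega)]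
        simp only [show w ≠ r + (t + 1) by omega, show w + 1 = r + (t + 1) by omega, if_false,
          if_true]
        rw [hw]
        push_cast
        field_simp
        rw [hkr]
        ring
      · rw [hmin1 (w + 1) (by omega), hmin1 (w + 1 + 1) (by omega)]
        by_cases hw' : w = r + (t + 1)
        · rw [hmin2 w (by omega)]
          simp only [hw', if_true, show r + (t + 1) + 1 ≠ r + (t + 1) by omega, if_false]
          push_cast
          field_simp
          rw [hkr]
          ring
        · rw [hmin1 w (by omega)]
          simp only [hw', if_false, show w + 1 ≠ r + (t + 1) by omega]
          ring
    have hX : (1 + Polynomial.C 1 * Polynomial.X : Polynomial ℝ) *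
        ((1 - Polynomial.X) ^ (2 * r) * (1 + Polynomial.X) ^ (k - (2 * r + 2)))
        = (1 - Polynomial.X) ^ (2 * r) * (1 + Polynomial.X) ^ (2 * (t + 1)) := by
      rw [show k - (2 * r + 2) = 2 * t + 1 by omega, Polynomial.C_1]
      ring
    rw [hfun, ← coeffPairing_one_add_C_mul_X_mul, hX, coeffPairing_single, hc,
      show (2 : ℝ) ^ k = 2 ^ (2 * (r + (t + 1))) * 2 by rw [hk, pow_succ]]
    field_simp
  -- For even `k` the kink is at an integer and the second difference is a single spike.
  · have hfun : (fun w : ℕ => min 1 (2 * (w : ℝ) / k) + -1 * min 1 (2 * ((w + 1 : ℕ) : ℝ) / k) +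
        -1 * (min 1 (2 * ((w + 1 : ℕ) : ℝ) / k) + -1 * min 1 (2 * ((w + 1 + 1 : ℕ) : ℝ) / k)))
        = fun w => if w = r + s then (-2 / k : ℝ) else 0 := by
      funext w
      have hkr : (k : ℝ) = 2 * (r + s) + 2 := by rw [hk]; push_cast; ring
      rcases lt_trichotomy w (r + s) with hw | hw | hw
      · rw [hmin2 _ (by omega), hmin2 _ (by omega), hmin2 _ (by omega), if_neg (by omega)]
        push_cast
        ring
      · rw [hmin2 w (by omega), hmin1 (w + 1) (by omega), hmin1 _ (by omega), if_pos hw, hw]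
        push_cast
        field_simp
        rw [hkr]
        ring
      · rw [hmin1 _ (by omega), hmin1 _ (by omega), hmin1 _ (by omega), if_neg (by omega)]
        ring
    rw [hfun, coeffPairing_single, show k - (2 * r + 2) = 2 * s by omega, hc,
      show (2 : ℝ) ^ k = 2 ^ (2 * (r + s)) * 4 by rw [hk, pow_add]; norm_num]
    field_simp
    ring

/-! ### Lower bounds for the weight of a single level and of the tail. -/

theorem choose_mul_le_fourierWeight {n k j : ℕ} {a : ℝ} (f : (Fin n → Bool) → ℝ) (hk : k ≤ n)
    (h : ∀ S : Finset (Fin n), (∀ i ∈ S, i.val < k) → S.card = j → cubeFourierCoeff f S ^ 2 = a) :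
    k.choose j * a ≤ fourierWeight f j := by
  have hcard : #{i : Fin n | i.val < k} = k := by rw [Fin.card_filter_val_lt]; omega
  calc (k.choose j * a : ℝ)
      = ∑ S ∈ powersetCard j ({i : Fin n | i.val < k} : Finset (Fin n)),
          cubeFourierCoeff f S ^ 2 := by
        rw [Finset.sum_congr rfl (g := fun _ => a), Finset.sum_const, card_powersetCard, hcard,
          nsmul_eq_mul]
        intro S hS
        rw [mem_powersetCard] at hS
        exact h S (fun i hi => (mem_filter.mp (hS.1 hi)).2) hS.2
    _ ≤ fourierWeight f j :=
        Finset.sum_le_sum_of_subset_of_nonneg (powersetCard_mono (Finset.subset_univ _))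
          fun _ _ _ => sq_nonneg _

theorem choose_two_mul_le_choose {k r s d : ℕ} (hk : k = 2 * (r + s) + 1 ∨ k = 2 * (r + s) + 2)
    (hd : 2 * d ≤ k) (hr : 4 * r + 1 ≤ 3 * d) :
    ((r + s + 1) * (2 * (r + s) + 1) / (8 * d ^ 2) : ℝ) * (2 * (r + s)).choose (2 * r)
      ≤ k.choose (2 * r + 2) := by
  have hrd : (r : ℝ) + 1 ≤ d := by exact_mod_cast (by omega : r + 1 ≤ d)
  have hd0 : (0 : ℝ) < d := by exact_mod_cast (by omega : 0 < d)
  have hden : ((2 * r + 2) * (2 * r + 1) : ℝ) ≤ 4 * d ^ 2 := by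
    have h0 : (0 : ℝ) ≤ r := r.cast_nonneg
    nlinarith
  obtain ⟨c, hcdef⟩ : ∃ c : ℝ, c = (2 * (r + s)).choose (2 * r) := ⟨_, rfl⟩
  rw [← hcdef]
  have hc0 : 0 ≤ c := hcdef ▸ Nat.cast_nonneg _
  -- Common to both parities: `v` is the target binomial and `u` its multiple after clearing `(2r +
  -- 2)(2r + 1)`, which is at most `4d^2`.
  have key : ∀ u : ℝ, (r + s + 1) * (2 * (r + s) + 1) / 2 * c ≤ u →
      ∀ v : ℝ, v * ((2 * r + 2) * (2 * r + 1)) = u →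
      ((r + s + 1) * (2 * (r + s) + 1) / (8 * d ^ 2) : ℝ) * c ≤ v := by
    rintro u hu v rfl
    have hv : 0 ≤ v := by
      by_contra! hv
      have : v * ((2 * r + 2) * (2 * r + 1)) < 0 := mul_neg_of_neg_of_pos hv (by positivity)
      have : (0 : ℝ) ≤ (r + s + 1) * (2 * (r + s) + 1) / 2 * c := by positivity
      linarith
    rw [div_mul_eq_mul_div, div_le_iff₀ (by positivity)]
    nlinarith [mul_le_mul_of_nonneg_left hden hv]
  rcases hk with hk | hk
  · have h1 : ((2 * (r + s)).choose (2 * r + 1) : ℝ) * (2 * r + 1) = c * (2 * s) := by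
      rw [hcdef]
      have := Nat.choose_succ_right_eq (2 * (r + s)) (2 * r)
      rw [show 2 * (r + s) - 2 * r = 2 * s by omega] at this
      exact_mod_cast this
    have h2 : (k.choose (2 * r + 2) : ℝ) * (2 * r + 2)
        = (2 * (r + s) + 1) * (2 * (r + s)).choose (2 * r + 1) := by
      rw [hk]
      exact_mod_cast (Nat.add_one_mul_choose_eq (2 * (r + s)) (2 * r + 1)).symm
    refine key ((2 * (r + s) + 1) * (2 * s) * c) ?_ _ ?_
    -- `2d ≤ k` and `4r + 1 ≤ 3d` give `r + 1 ≤ 3s`, so `s` is comparable with `k`.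
    · have hs : ((r : ℝ) + s + 1) ≤ 4 * s := by exact_mod_cast (by omega : r + s + 1 ≤ 4 * s)
      have : (0 : ℝ) ≤ (2 * (r + s) + 1) * c := by positivity
      nlinarith [mul_le_mul_of_nonneg_right hs this]
    · linear_combination (2 * r + 1 : ℝ) * h2 + (2 * (r + s) + 1 : ℝ) * h1
  · have h1 : ((2 * (r + s) + 1).choose (2 * r + 1) : ℝ) * (2 * r + 1)
        = (2 * (r + s) + 1) * c := by
      rw [hcdef]
      exact_mod_cast (Nat.add_one_mul_choose_eq (2 * (r + s)) (2 * r)).symm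
    have h2 : (k.choose (2 * r + 2) : ℝ) * (2 * r + 2)
        = (2 * (r + s) + 2) * (2 * (r + s) + 1).choose (2 * r + 1) := by
      rw [hk]
      exact_mod_cast (Nat.add_one_mul_choose_eq (2 * (r + s) + 1) (2 * r + 1)).symm
    refine key ((2 * (r + s) + 2) * (2 * (r + s) + 1) * c) ?_ _ ?_
    · have : (0 : ℝ) ≤ (r + s + 1) * (2 * (r + s) + 1) * c := by positivity
      linarith
    · linear_combination (2 * r + 1 : ℝ) * h2 + (2 * (r + s) + 2 : ℝ) * h1

theorem le_fourierWeight_hockeyStick {n k r s d : ℕ} (hkn : k ≤ n)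
    (hk : k = 2 * (r + s) + 1 ∨ k = 2 * (r + s) + 2) (hd : 2 * d ≤ k) (hr : 4 * r + 1 ≤ 3 * d) :
    1 / (512 * (d ^ 2 * Real.sqrt d) * k) ≤ fourierWeight (hockeyStick n k) (2 * r + 2) := by
  have hd0 : (0 : ℝ) < d := by exact_mod_cast (by omega : 0 < d)
  have hk0 : (0 : ℝ) < k := by exact_mod_cast (by omega : 0 < k)
  refine le_trans ?_ (choose_mul_le_fourierWeight (hockeyStick n k) hkn
    (a := (superCatalan r s / 4 ^ (r + s)) ^ 2 / (4 * k ^ 2)) fun S hS hcard => ?_)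
  swap
  · rw [cubeFourierCoeff_hockeyStick hkn hk hS hcard (by omega), div_pow, neg_sq, div_pow, mul_pow,
      ← pow_mul, mul_comm r 2, pow_mul, neg_one_sq, one_pow, one_mul, div_pow, mul_pow]
    norm_num
  set a : ℕ → ℝ := fun m => (m.centralBinom : ℝ) / 4 ^ m with ha
  have hsd : 0 < Real.sqrt d := Real.sqrt_pos.mpr hd0
  have har : 1 / (2 * Real.sqrt d) ≤ a r := by
    refine le_trans ?_ (inv_le_centralBinom_div_four_pow r)
    have hrd : (r : ℝ) + 1 ≤ d := by exact_mod_cast (by omega : r + 1 ≤ d)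
    gcongr
  have hasM : 1 / (4 * (r + s + 1) : ℝ) ≤ a s * a (r + s) := by
    have h1 : 1 / (2 * Real.sqrt (r + s + 1)) ≤ a s := by
      refine le_trans ?_ (inv_le_centralBinom_div_four_pow s)
      gcongr
      linarith [(r.cast_nonneg : (0 : ℝ) ≤ r)]
    have h2 : 1 / (2 * Real.sqrt (r + s + 1)) ≤ a (r + s) := by
      have := inv_le_centralBinom_div_four_pow (r + s)
      push_cast at this
      exact this
    refine le_trans (le_of_eq ?_) (mul_le_mul h1 h2 (by positivity) (by positivity))
    rw [div_mul_div_comm, one_mul, mul_mul_mul_comm, Real.mul_self_sqrt (by positivity)]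
    norm_num
  have hid : ((2 * (r + s)).choose (2 * r) : ℝ) * (superCatalan r s / 4 ^ (r + s)) ^ 2
      = a r * (a s * a (r + s)) := by
    rw [div_pow, mul_div_assoc', choose_mul_superCatalan_sq, ha]
    simp only [pow_add]
    field_simp
  -- In the calculation below, `r + s + 1` cancels against `hasM`, while `2(r + s) + 1` is of order
  -- `k` and cancels one of the two factors `k`.
  have hkM : (k : ℝ) ≤ 2 * (2 * (r + s) + 1) := by
    exact_mod_cast (by omega : k ≤ 2 * (2 * (r + s) + 1))
  calc (1 / (512 * (d ^ 2 * Real.sqrt d) * k) : ℝ)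
      = k / (512 * (d ^ 2 * Real.sqrt d) * k ^ 2) := by field_simp
    _ ≤ 2 * (2 * (r + s) + 1) / (512 * (d ^ 2 * Real.sqrt d) * k ^ 2) := by gcongr
    _ = ((r + s + 1) * (2 * (r + s) + 1) / (8 * d ^ 2)) *
          (1 / (2 * Real.sqrt d) * (1 / (4 * (r + s + 1)))) / (4 * k ^ 2) := by
        field_simp
        norm_num
    _ ≤ ((r + s + 1) * (2 * (r + s) + 1) / (8 * d ^ 2)) *
          (a r * (a s * a (r + s))) / (4 * k ^ 2) := by gcongr
    _ = ((r + s + 1) * (2 * (r + s) + 1) / (8 * d ^ 2)) * (2 * (r + s)).choose (2 * r) *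
          ((superCatalan r s / 4 ^ (r + s)) ^ 2 / (4 * k ^ 2)) := by
        rw [← hid]
        ring
    _ ≤ k.choose (2 * r + 2) * ((superCatalan r s / 4 ^ (r + s)) ^ 2 / (4 * k ^ 2)) :=
        mul_le_mul_of_nonneg_right (choose_two_mul_le_choose hk hd hr) (by positivity)

theorem le_fourierWeightAbove_hockeyStick {n k d : ℕ} (hkn : k ≤ n) (hd1 : 1 ≤ d)
    (hd : 2 * d ≤ k) :
    1 / (2048 * (d * Real.sqrt d) * k) ≤ fourierWeightAbove (hockeyStick n k) d := by
  have hd0 : (0 : ℝ) < d := by exact_mod_cast hd1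
  have hk0 : (0 : ℝ) < k := by exact_mod_cast (by omega : 0 < k)
  have hsd : 0 < Real.sqrt d := Real.sqrt_pos.mpr hd0
  -- The levels used are `2r + 2` with `r = ⌊d/2⌋ + i` and `i < ⌈d/4⌉`: they lie above `d`, and the
  -- range of `i` is exactly what keeps `4r + 1 ≤ 3d`.
  have hcount : (d : ℝ) ≤ 4 * ((d + 3) / 4 : ℕ) := by
    exact_mod_cast (by omega : d ≤ 4 * ((d + 3) / 4))
  calc (1 / (2048 * (d * Real.sqrt d) * k) : ℝ)
      = (d / 4) * (1 / (512 * (d ^ 2 * Real.sqrt d) * k)) := by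
        field_simp
        norm_num
    _ ≤ ((d + 3) / 4 : ℕ) * (1 / (512 * (d ^ 2 * Real.sqrt d) * k)) := by
        gcongr
        linarith
    _ = ∑ i ∈ range ((d + 3) / 4), 1 / (512 * (d ^ 2 * Real.sqrt d) * k) := by
        rw [sum_const, card_range, nsmul_eq_mul]
    _ ≤ ∑ i ∈ range ((d + 3) / 4), fourierWeight (hockeyStick n k) (2 * (d / 2 + i) + 2) :=
        sum_le_sum fun i hi => by
          rw [mem_range] at hi
          refine le_fourierWeight_hockeyStick (s := (k - 1) / 2 - (d / 2 + i)) hkn ?_ hd ?_ <;>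
            omega
    _ = ∑ j ∈ (range ((d + 3) / 4)).image fun i => 2 * (d / 2 + i) + 2,
          fourierWeight (hockeyStick n k) j := by
        rw [sum_image]
        intro i _ j _ h
        simpa using h
    _ ≤ fourierWeightAbove (hockeyStick n k) d := by
        refine sum_le_sum_of_subset_of_nonneg ?_ fun _ _ _ => fourierWeight_nonneg _ _
        intro j hj
        simp only [mem_image, mem_range] at hj
        obtain ⟨i, hi, rfl⟩ := hj
        rw [mem_Ioc]
        omega

/-! ### The cutoff `k/2` and the scaling `k ≈ ε^(-4/5)`. -/

theorem fourierWeightAbove_hockeyStick_one {n : ℕ} (hn : 1 ≤ n) :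
    1 / 4 ≤ fourierWeightAbove (hockeyStick n 1) 0 := by
  have h := choose_mul_le_fourierWeight (j := 1) (a := 1 / 4) (hockeyStick n 1) hn
    fun S hS hcard => by
      have h := sum_mul_parity_eq_coeffPairing hn (fun w => min 1 (2 * (w : ℝ) / (1 : ℕ))) S hS
      have h1X : (1 - Polynomial.X : Polynomial ℝ)
          = (1 + Polynomial.C (-1) * Polynomial.X) * (Polynomial.C 1 * Polynomial.X ^ 0) := by
        simp [sub_eq_add_neg]
      rw [hcard, Nat.sub_self, pow_zero, pow_one, mul_one, h1X, coeffPairing_one_add_C_mul_X_mul,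
        coeffPairing_C_mul_X_pow] at h
      rw [cubeFourierCoeff, cubeMean]
      simp only [hockeyStick]
      rw [h, show (2 : ℝ) ^ n = 2 ^ (n - 1) * 2 by rw [← pow_succ, Nat.sub_add_cancel hn]]
      have : (2 : ℝ) ^ (n - 1) ≠ 0 := by positivity
      field_simp
      norm_num
  norm_num at h
  refine h.trans ?_
  rw [fourierWeightAbove]
  exact single_le_sum (f := fourierWeight (hockeyStick n 1)) (fun _ _ => fourierWeight_nonneg _ _)
    (mem_Ioc.mpr ⟨one_pos, hn⟩)

theorem le_fourierWeightAbove_hockeyStick_half {n k : ℕ} (hk : 1 ≤ k) (hkn : k ≤ n) :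
    1 / (2048 * (k ^ 2 * Real.sqrt k)) ≤ fourierWeightAbove (hockeyStick n k) (k / 2) := by
  rcases hk.eq_or_lt with rfl | hk
  -- For `k = 1` the cutoff is `0`, outside the range `1 ≤ d`; level 1 alone suffices.
  · exact le_trans (by norm_num) (fourierWeightAbove_hockeyStick_one hkn)
  refine le_trans ?_ (le_fourierWeightAbove_hockeyStick hkn (by omega) (by omega))
  have hd0 : (0 : ℝ) < (k / 2 : ℕ) := by exact_mod_cast (by omega : 0 < k / 2)
  have hdk : ((k / 2 : ℕ) : ℝ) ≤ k := by exact_mod_cast Nat.div_le_self k 2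
  have hk0 : (0 : ℝ) < k := hd0.trans_le hdk
  have := Real.sqrt_pos.mpr hd0
  calc (1 / (2048 * (k ^ 2 * Real.sqrt k)) : ℝ) = 1 / (2048 * (k * Real.sqrt k) * k) := by ring
    _ ≤ _ := by gcongr

theorem sq_lt_of_le_rpow {ε k : ℝ} (hε : 0 < ε) (hk : 0 < k)
    (h : k ≤ 1 / 64 * ε ^ (-(4 / 5) : ℝ)) : ε ^ 2 < 1 / (2048 * (k ^ 2 * Real.sqrt k)) := by
  set y := ε ^ (-(4 / 5) : ℝ) with hy
  have hy0 : 0 < y := Real.rpow_pos_of_pos hε _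
  have hεy : ε ^ 2 * (y ^ 2 * Real.sqrt y) = 1 := by
    rw [Real.sqrt_eq_rpow, hy, ← Real.rpow_mul hε.le, ← Real.rpow_natCast, ← Real.rpow_natCast,
      ← Real.rpow_mul hε.le, ← Real.rpow_add hε, ← Real.rpow_add hε]
    norm_num
  have hsk : 8 * Real.sqrt k ≤ Real.sqrt y := by
    refine Real.le_sqrt_of_sq_le ?_
    rw [mul_pow, Real.sq_sqrt hk.le]
    linarith
  have hsk0 : 0 < Real.sqrt k := Real.sqrt_pos.mpr hk
  -- `64^2 * 8 = 16 * 2048`; the spare factor 16 makes the inequality strict, as `lt_approxDegree`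
  -- requires.
  have hle : (64 * k) ^ 2 * (8 * Real.sqrt k) ≤ y ^ 2 * Real.sqrt y := by
    have : 64 * k ≤ y := by linarith
    gcongr
  have hpos : 0 < k ^ 2 * Real.sqrt k := by positivity
  rw [lt_div_iff₀ (by positivity)]
  have := mul_le_mul_of_nonneg_left hle (sq_nonneg ε)
  nlinarith [mul_pos (pow_pos hε 2) hpos]

theorem mainTheorem3 :
    -- the spectral lower bound
    (∃ c : ℝ, 0 < c ∧ ∀ n k d : ℕ, k ≤ n → 1 ≤ d → (d : ℝ) ≤ (k : ℝ) / 2 →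
      c * ((d : ℝ) ^ (-(3 / 2) : ℝ) / (k : ℝ)) ≤ fourierWeightAbove (hockeyStick n k) d) ∧
    -- the choice `k = c₁ ε^{-4/5}`, and the resulting lower bound on the approximate degree
    (∃ c₁ c₂ : ℝ, 0 < c₁ ∧ 0 < c₂ ∧ ∀ (ε : ℝ) (n k : ℕ), 0 < ε →
      k = ⌊c₁ * ε ^ (-(4 / 5) : ℝ)⌋₊ → 1 ≤ k → k ≤ n →
        ε ^ 2 ≤ fourierWeightAbove (hockeyStick n k) (k / 2) ∧
        c₂ * ε ^ (-(4 / 5) : ℝ) ≤ (approxDegree ε (hockeyStick n k) : ℝ)) ∧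
    -- `hs_k` is `[0,1]`-valued, monotone, submodular, and symmetric in its `k` variables
    (∀ n k : ℕ, 1 ≤ k → k ≤ n →
      (∀ x, hockeyStick n k x ∈ Set.Icc (0 : ℝ) 1) ∧
      Monotone (hockeyStick n k) ∧
      Submodular (hockeyStick n k) ∧
      (∀ σ : Equiv.Perm (Fin n), (∀ i, (σ i).val < k ↔ i.val < k) →
        ∀ x, hockeyStick n k (x ∘ σ) = hockeyStick n k x)) := by
  refine ⟨⟨1 / 2048, by norm_num, fun n k d hkn hd1 hd => ?_⟩,
    ⟨1 / 64, 1 / 256, by norm_num, by norm_num, fun ε n k hε hk hk1 hkn => ?_⟩,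
    fun n k _ _ => ⟨hockeyStick_mem_Icc n k, hockeyStick_monotone n k, hockeyStick_submodular n k,
      fun σ hσ x => hockeyStick_comp_perm σ hσ x⟩⟩
  · have hd' : 2 * d ≤ k := by
      have : (2 * d : ℝ) ≤ k := by linarith
      exact_mod_cast this
    have hd0 : (0 : ℝ) < d := by exact_mod_cast hd1
    refine le_trans (le_of_eq ?_) (le_fourierWeightAbove_hockeyStick hkn hd1 hd')
    rw [Real.rpow_neg hd0.le, show (3 / 2 : ℝ) = 1 + 1 / 2 by norm_num, Real.rpow_add hd0,
      Real.rpow_one, ← Real.sqrt_eq_rpow]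
    field_simp
  · have hy0 : 0 < ε ^ (-(4 / 5) : ℝ) := Real.rpow_pos_of_pos hε _
    have hle : (k : ℝ) ≤ 1 / 64 * ε ^ (-(4 / 5) : ℝ) := hk ▸ Nat.floor_le (by positivity)
    have hlt : 1 / 64 * ε ^ (-(4 / 5) : ℝ) < k + 1 := hk ▸ Nat.lt_floor_add_one _
    have hW := (sq_lt_of_le_rpow hε (by exact_mod_cast hk1) hle).trans_le
      (le_fourierWeightAbove_hockeyStick_half hk1 hkn)
    refine ⟨hW.le, ?_⟩
    have hdeg := lt_approxDegree hε.le hW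
    -- The degree exceeds `⌊k/2⌋`, so twice it is at least `k + 1`, which is greater than
    -- `ε^(-4/5)/64`.
    have hdeg' : (k : ℝ) + 1 ≤ 2 * approxDegree ε (hockeyStick n k) := by
      exact_mod_cast (by omega : k + 1 ≤ 2 * approxDegree ε (hockeyStick n k))
    linarith
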